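/- For a positive integer $d$ and positive integers $s_1,\dots,s_d$ with $s_1>1$, let $$\zeta(s_1,\dots,s_d)=\sum_{k_1>\cdots>k_d>0}\frac{1}{k_1^{s_1}\cdots k_d^{s_d}}$$ be the multiple zeta value, and let $$G_d(x_1,\dots,x_d)=\sum_{s_1,\dots,s_d\ge 1,\ s_1>1}x_1^{s_1-1}\cdots x_d^{s_d-1}\,\zeta(s_1,\dots,s_d)$$ be the generating function of the multiple zeta values of depth $d$. Let $x_1,x_2$ be nonzero complex numbers with $|x_1|<2$ and $|x_2|<1$. Then all the series below, including those that define the values of $G_2$ and $G_3$, converge absolutely, and $$G_3(x_1,x_1,x_2)+G_3(x_1,x_2,x_2)-\frac{1}{x_1}G_2(x_1,x_2)-\frac{1}{x_2}G_2(x_1,x_2)$$ $$=\sum_{s_1\ge 2,\,s_2\ge 1}x_1^{s_1-1}x_2^{s_2-1}\zeta(s_1,1,s_2)-\sum_{s\ge 1}x_2^{s-1}\zeta(2,s)-\frac{1}{x_2}\sum_{s\ge 2}x_1^{s-1}\zeta(s,1).$$ -/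

import Mathlib

/-- The term `1 / (k₁ ^ s₁ ⋯ k_d ^ s_d)` of the series of a multiple zeta value. -/
noncomputable def mzvTerm {d : ℕ} (s k : Fin d → ℕ) : ℝ :=
  ∏ i, 1 / (k i : ℝ) ^ s i

/-- The summation range `k₁ > ⋯ > k_d > 0`. -/
abbrev MzvRange (d : ℕ) : Type :=
  {k : Fin d → ℕ // StrictAnti k ∧ ∀ i, 0 < k i}

/-- The multiple zeta value `ζ(s₁, …, s_d) = ∑_{k₁ > ⋯ > k_d > 0} 1 / (k₁ ^ s₁ ⋯ k_d ^ s_d)`. -/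
noncomputable def mzv {d : ℕ} (s : Fin d → ℕ) : ℝ :=
  ∑' k : MzvRange d, mzvTerm s k.1

/-- The exponents `s₁, …, s_d ≥ 1` with `s₁ > 1`. -/
abbrev MzvIndex (d : ℕ) [NeZero d] : Type :=
  {s : Fin d → ℕ // (∀ i, 1 ≤ s i) ∧ 1 < s 0}

/-- The term `x₁ ^ (s₁ - 1) ⋯ x_d ^ (s_d - 1) ζ(s₁, …, s_d)` of the generating series. -/
noncomputable def mzvGenTerm (d : ℕ) [NeZero d] (x : Fin d → ℂ) (s : MzvIndex d) : ℂ :=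
  (∏ i, x i ^ (s.1 i - 1)) * (mzv s.1 : ℂ)

/-- The generating function `G_d(x₁, …, x_d)` of the multiple zeta values of depth `d`. -/
noncomputable def mzvGen (d : ℕ) [NeZero d] (x : Fin d → ℂ) : ℂ :=
  ∑' s : MzvIndex d, mzvGenTerm d x s

theorem summable_prod_fin {f : ℕ → ℝ} (hf : Summable f) (h0 : ∀ n, 0 ≤ f n) (d : ℕ) :
    Summable fun k : Fin d → ℕ => ∏ i, f (k i) := by
  induction d with
  | zero => exact (hasSum_fintype _).summable
  | succ d ih =>
    rw [← (Fin.consEquiv fun _ : Fin (d + 1) => ℕ).summable_iff]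
    have h := hf.mul_of_nonneg ih h0 (fun k => Finset.prod_nonneg fun i _ => h0 (k i))
    refine h.congr fun p => ?_
    simp [Fin.consEquiv, Fin.prod_univ_succ]

/-- For exponents `s₁, …, s_d ≥ 1` with `s₁ > 1` the series of the multiple zeta value converges. -/
theorem summable_mzvTerm (d : ℕ) [NeZero d] (s : MzvIndex d) :
    Summable fun k : MzvRange d => mzvTerm s.1 k.1 := by
  have hd : (0 : ℝ) < d := by exact_mod_cast Nat.pos_of_ne_zero (NeZero.ne d)
  have hp : (1 : ℝ) < 1 + 1 / d := by
    have : (0 : ℝ) < 1 / d := by positivity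
    linarith
  have hsum := summable_prod_fin (Real.summable_one_div_nat_rpow.2 hp)
    (fun n => by positivity) d
  refine Summable.of_nonneg_of_le (fun k => Finset.prod_nonneg fun i _ => by positivity) ?_
    (hsum.comp_injective (Subtype.val_injective (p := fun k : Fin d → ℕ =>
      StrictAnti k ∧ ∀ i, 0 < k i)))
  rintro ⟨k, hk, hpos⟩
  have hk1 : ∀ i, (1 : ℝ) ≤ k i := fun i => by exact_mod_cast hpos i
  have hk0 : ∀ i, (0 : ℝ) < k i := fun i => lt_of_lt_of_le one_pos (hk1 i)
  simp only [mzvTerm, Function.comp, Finset.prod_div_distrib, Finset.prod_const_one]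
  refine one_div_le_one_div_of_le
    (Finset.prod_pos fun i _ => Real.rpow_pos_of_pos (hk0 i) _) ?_
  have h1 : ∏ i, (k i : ℝ) ^ (1 + 1 / (d : ℝ)) ≤ (∏ i, (k i : ℝ)) * k 0 := by
    have : ∀ i, (k i : ℝ) ^ (1 + 1 / (d : ℝ)) ≤ k i * (k 0 : ℝ) ^ (1 / (d : ℝ)) := by
      intro i
      rw [Real.rpow_add (hk0 i), Real.rpow_one]
      refine mul_le_mul_of_nonneg_left ?_ (hk0 i).le
      refine Real.rpow_le_rpow (hk0 i).le ?_ (by positivity)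
      exact_mod_cast hk.antitone (Fin.zero_le i)
    refine (Finset.prod_le_prod (fun i _ => by positivity) fun i _ => this i).trans ?_
    rw [Finset.prod_mul_distrib, Finset.prod_const, Finset.card_univ, Fintype.card_fin,
      ← Real.rpow_natCast, ← Real.rpow_mul (hk0 0).le, one_div_mul_cancel hd.ne', Real.rpow_one]
  refine h1.trans ?_
  rw [← Finset.mul_prod_erase Finset.univ (fun i => (k i : ℝ)) (Finset.mem_univ 0),
    ← Finset.mul_prod_erase Finset.univ (fun i => (k i : ℝ) ^ s.1 i) (Finset.mem_univ 0)]
  have h2 : (k 0 : ℝ) * k 0 ≤ (k 0 : ℝ) ^ s.1 0 := by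
    rw [← sq]; exact pow_le_pow_right₀ (hk1 0) s.2.2
  have h3 : ∏ i ∈ Finset.univ.erase 0, (k i : ℝ) ≤ ∏ i ∈ Finset.univ.erase 0, (k i : ℝ) ^ s.1 i :=
    Finset.prod_le_prod (fun i _ => (hk0 i).le) fun i _ =>
      le_self_pow₀ (hk1 i) (by have := s.2.1 i; omega)
  calc (k 0 : ℝ) * (∏ i ∈ Finset.univ.erase 0, (k i : ℝ)) * k 0
      = ((k 0 : ℝ) * k 0) * ∏ i ∈ Finset.univ.erase 0, (k i : ℝ) := by ring
    _ ≤ _ := mul_le_mul h2 h3 (Finset.prod_nonneg fun i _ => (hk0 i).le) (by positivity)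

/-! Write u = x₁, v = x₂ and f(k) = 1/(k - u) - 1/k. Summing geometric series over the exponents
turns every series in the theorem into a sum of rational functions over k > m > n > 0 or k > n > 0;
for instance G₃(u, w, v) = ∑ f(k) / ((m - w)(n - v)). The interchange is legitimate because the rows
are dominated by multiples of ζ(2,1,1) or ζ(2,1).

The core is `hasSum_two_of_hasSum_three`. Its device is an auxiliary sum β = ∑ f(k) / ((k - m)(n -
v)), unchanged when k - m is replaced by m - n, since exchanging these two gaps fixes k and n. One
form is added to G₃(u, u, v), and G₃(u, v, v) is subtracted from the other. By partial fractions, k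
can then be summed out of the former and n out of the latter. After renaming indices, G₃(u, u, v) +
β, β - G₃(u, v, v) and the series with ζ(s₁, 1, s₂) are sums over k > n > 0 of f(k)/(n - v) times
H_k, H_{n-1} and H_{k-1} - H_n. In the required combination only 1/k + 1/n survives, and partial
fractions in k and n give the depth two series. -/

/-! ### Absolutely convergent series and geometric series. -/

/-- The series `∑ f i` converges absolutely to `s`, and the sum of the norms is at most `b`. -/
structure AbsHasSum {ι : Type*} (f : ι → ℂ) (s : ℂ) (b : ℝ) : Prop where
  hasSum : HasSum f s
  summable_norm : Summable fun i => ‖f i‖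
  tsum_norm_le : ∑' i, ‖f i‖ ≤ b

namespace AbsHasSum

theorem mul {ι κ : Type*} {f : ι → ℂ} {g : κ → ℂ} {s t : ℂ} {b c : ℝ}
    (hf : AbsHasSum f s b) (hg : AbsHasSum g t c) :
    AbsHasSum (fun i : ι × κ => f i.1 * g i.2) (s * t) (b * c) := by
  have hn := hf.summable_norm.mul_of_nonneg hg.summable_norm (fun _ => norm_nonneg _)
    (fun _ => norm_nonneg _)
  refine ⟨hf.hasSum.mul hg.hasSum
    (summable_mul_of_summable_norm hf.summable_norm hg.summable_norm), ?_, ?_⟩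
  · simpa only [norm_mul] using hn
  · simp only [norm_mul]
    rw [← hf.summable_norm.tsum_mul_tsum hg.summable_norm hn]
    exact mul_le_mul hf.tsum_norm_le hg.tsum_norm_le (tsum_nonneg fun _ => norm_nonneg _)
      ((tsum_nonneg fun _ => norm_nonneg _).trans hf.tsum_norm_le)

theorem mono {ι : Type*} {f : ι → ℂ} {s : ℂ} {b c : ℝ} (h : AbsHasSum f s b) (hbc : b ≤ c) :
    AbsHasSum f s c :=
  ⟨h.hasSum, h.summable_norm, h.tsum_norm_le.trans hbc⟩

/-- Interchange of summation for a double series with absolutely summable rows. -/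
theorem swap {ι κ : Type*} {T : ι → κ → ℂ} {F : κ → ℂ} {B : κ → ℝ} (hB : Summable B)
    (h : ∀ x, AbsHasSum (fun i => T i x) (F x) (B x)) :
    Summable (fun i => ∑' x, T i x) ∧ HasSum F (∑' i, ∑' x, T i x) := by
  have hs : Summable fun y : κ × ι => ‖T y.2 y.1‖ := by
    rw [summable_prod_of_nonneg fun _ => norm_nonneg _]
    refine ⟨fun x => (h x).summable_norm, ?_⟩
    exact Summable.of_nonneg_of_le (fun x => tsum_nonneg fun _ => norm_nonneg _)
      (fun x => (h x).tsum_norm_le) hB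
  have hs' : Summable fun y : κ × ι => T y.2 y.1 := hs.of_norm
  have hs2 : Summable fun y : ι × κ => T y.1 y.2 := hs'.prod_symm
  refine ⟨hs2.prod, ?_⟩
  have := hs'.hasSum.prod_fiberwise fun x => (h x).hasSum
  rwa [show ∑' y : κ × ι, T y.2 y.1 = ∑' i, ∑' x, T i x by
    rw [← hs2.tsum_prod]; exact (Equiv.prodComm κ ι).tsum_eq fun y : ι × κ => T y.1 y.2] at this

theorem mul_const {ι : Type*} {f : ι → ℂ} {s : ℂ} {b : ℝ} (h : AbsHasSum f s b) (z : ℂ) :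
    AbsHasSum (fun i => f i * z) (s * z) (b * ‖z‖) := by
  refine ⟨h.hasSum.mul_right z, ?_, ?_⟩ <;> simp only [norm_mul]
  · exact h.summable_norm.mul_right _
  · rw [tsum_mul_right]
    exact mul_le_mul_of_nonneg_right h.tsum_norm_le (norm_nonneg z)

/-- The geometric series `∑ x ^ i / k ^ (i + 1) = 1 / (k - x)` for `‖x‖ < K ≤ k`. -/
theorem geom {x : ℂ} {K k : ℕ} (hx : ‖x‖ < K) (hk : K ≤ k) :
    AbsHasSum (fun i : ℕ => x ^ i / (k : ℂ) ^ (i + 1)) (1 / (k - x))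
      (K / (K - ‖x‖) * (1 / k)) := by
  have hK : (0 : ℝ) < K := (norm_nonneg x).trans_lt hx
  have hkK : (K : ℝ) ≤ k := by exact_mod_cast hk
  have hk0 : (0 : ℝ) < k := hK.trans_le hkK
  have hkc : (k : ℂ) ≠ 0 := by exact_mod_cast hk0.ne'
  have hxk : ‖x‖ < k := hx.trans_le hkK
  have hsub : (k : ℂ) - x ≠ 0 := by
    rw [sub_ne_zero]; rintro rfl; simp at hxk
  have hr : ‖x / k‖ < 1 := by
    rw [norm_div, Complex.norm_natCast, div_lt_one hk0]; exact hxk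
  have hr' : ‖x‖ / k < 1 := by rwa [div_lt_one hk0]
  have hn : HasSum (fun i : ℕ => ‖x ^ i / (k : ℂ) ^ (i + 1)‖) (1 / (k - ‖x‖)) := by
    have e₁ : (fun i : ℕ => ‖x ^ i / (k : ℂ) ^ (i + 1)‖) = fun i => (‖x‖ / k) ^ i / k := by
      ext i
      rw [norm_div, norm_pow, norm_pow, Complex.norm_natCast, div_pow, pow_succ, div_div]
    have e₂ : 1 / (k - ‖x‖) = (1 - ‖x‖ / k)⁻¹ / k := by
      have : (k : ℝ) - ‖x‖ ≠ 0 := by linarith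
      field_simp
    rw [e₁, e₂]
    exact (hasSum_geometric_of_lt_one (by positivity) hr').div_const (k : ℝ)
  refine ⟨?_, hn.summable, ?_⟩
  · have e₁ : (fun i : ℕ => x ^ i / (k : ℂ) ^ (i + 1)) = fun i => (x / k) ^ i / k := by
      ext i
      rw [div_pow, pow_succ, div_div]
    have e₂ : 1 / (k - x) = (1 - x / k)⁻¹ / k := by
      field_simp
    rw [e₁, e₂]
    exact (hasSum_geometric_of_norm_lt_one hr).div_const (k : ℂ)
  -- Clearing denominators leaves K‖x‖ ≤ k‖x‖. The constant K / (K - ‖x‖) does not depend on k, so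
  -- the bound can be summed over k.
  · rw [hn.tsum_eq, div_mul_div_comm, mul_one, div_le_div_iff₀ (by linarith)
      (mul_pos (by linarith) hk0)]
    nlinarith [norm_nonneg x]

/-- The geometric series `∑ x ^ (i + 1) / k ^ (i + 2) = 1 / (k - x) - 1 / k` for `‖x‖ < K ≤ k`. -/
theorem geom_succ {x : ℂ} {K k : ℕ} (hx : ‖x‖ < K) (hk : K ≤ k) :
    AbsHasSum (fun i : ℕ => x ^ (i + 1) / (k : ℂ) ^ (i + 2)) (1 / (k - x) - 1 / k)
      (‖x‖ * K / (K - ‖x‖) * (1 / k ^ 2)) := by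
  have h := (geom hx hk).mul_const (x / k)
  have hK : (0 : ℝ) < K := (norm_nonneg x).trans_lt hx
  have hkK : (K : ℝ) ≤ k := by exact_mod_cast hk
  have hk0 : (0 : ℝ) < k := hK.trans_le hkK
  have hkc : (k : ℂ) ≠ 0 := by exact_mod_cast hk0.ne'
  have hsub : (k : ℂ) - x ≠ 0 := by
    rw [sub_ne_zero]; rintro rfl; simp at hx; linarith
  have e₁ : (fun i : ℕ => x ^ (i + 1) / (k : ℂ) ^ (i + 2)) =
      fun i : ℕ => x ^ i / (k : ℂ) ^ (i + 1) * (x / k) := by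
    ext i
    rw [div_mul_div_comm, ← pow_succ, ← pow_succ]
  have e₂ : 1 / (k - x) - 1 / k = 1 / (k - x) * (x / k) := by
    field_simp
    ring
  rw [e₁, e₂]
  refine h.mono (le_of_eq ?_)
  rw [norm_div, Complex.norm_natCast]
  field_simp

end AbsHasSum

/-! ### Coordinates on summation ranges and exponents. -/

/-- Coordinates `(a, b, c)` on the triples `k > m > n > 0`: `n = c + 1`, `m = n + b + 1`,
`k = m + a + 1`. -/
def mzvRangeEquivThree : ℕ × ℕ × ℕ ≃ MzvRange 3 where
  toFun x := ⟨![x.2.2 + x.2.1 + x.1 + 3, x.2.2 + x.2.1 + 2, x.2.2 + 1], by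
    refine ⟨Fin.strictAnti_iff_succ_lt.2 fun i => ?_, fun i => ?_⟩ <;> fin_cases i <;> simp⟩
  invFun k := (k.1 0 - k.1 1 - 1, k.1 1 - k.1 2 - 1, k.1 2 - 1)
  left_inv x := by
    ext <;> simp <;> omega
  right_inv k := by
    have h0 : k.1 1 < k.1 0 := k.2.1 (by decide)
    have h1 : k.1 2 < k.1 1 := k.2.1 (by decide)
    have h2 := k.2.2 2
    ext i
    fin_cases i <;> simp <;> omega

/-- Coordinates `(p, q)` on the pairs `k > n > 0`: `n = q + 1`, `k = n + p + 1`. -/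
def mzvRangeEquivTwo : ℕ × ℕ ≃ MzvRange 2 where
  toFun x := ⟨![x.2 + x.1 + 2, x.2 + 1], by
    refine ⟨Fin.strictAnti_iff_succ_lt.2 fun i => ?_, fun i => ?_⟩ <;> fin_cases i <;> simp⟩
  invFun k := (k.1 0 - k.1 1 - 1, k.1 1 - 1)
  left_inv x := by
    ext <;> simp <;> omega
  right_inv k := by
    have h0 : k.1 1 < k.1 0 := k.2.1 (by decide)
    have h1 := k.2.2 1
    ext i
    fin_cases i <;> simp <;> omega

def mzvIndexEquivThree : ℕ × ℕ × ℕ ≃ MzvIndex 3 where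
  toFun x := ⟨![x.1 + 2, x.2.1 + 1, x.2.2 + 1], by
    refine ⟨fun i => ?_, ?_⟩
    · fin_cases i <;> simp
    · simp⟩
  invFun s := (s.1 0 - 2, s.1 1 - 1, s.1 2 - 1)
  left_inv x := by
    ext <;> simp
  right_inv s := by
    have h0 := s.2.2
    have h1 := s.2.1 1
    have h2 := s.2.1 2
    ext i
    fin_cases i <;> simp <;> omega

def mzvIndexEquivTwo : ℕ × ℕ ≃ MzvIndex 2 where
  toFun x := ⟨![x.1 + 2, x.2 + 1], by
    refine ⟨fun i => ?_, ?_⟩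
    · fin_cases i <;> simp
    · simp⟩
  invFun s := (s.1 0 - 2, s.1 1 - 1)
  left_inv x := by
    ext <;> simp
  right_inv s := by
    have h0 := s.2.2
    have h1 := s.2.1 1
    ext i
    fin_cases i <;> simp <;> omega

/-! ### Generating series as sums of rational functions. -/

theorem mul_mzv_three (z : ℂ) (r s t : ℕ) :
    z * (mzv ![r, s, t] : ℂ) = ∑' x : ℕ × ℕ × ℕ,
      z / (((x.2.2 + x.2.1 + x.1 + 3 : ℕ) : ℂ) ^ r * ((x.2.2 + x.2.1 + 2 : ℕ) : ℂ) ^ s *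
        ((x.2.2 + 1 : ℕ) : ℂ) ^ t) := by
  rw [mzv, ← mzvRangeEquivThree.tsum_eq, Complex.ofReal_tsum, ← tsum_mul_left]
  refine tsum_congr fun x => ?_
  simp only [mzvTerm, mzvRangeEquivThree, Equiv.coe_fn_mk, Fin.prod_univ_three]
  rw [div_eq_mul_inv]
  congr 1
  simp
  ring

theorem mul_mzv_two (z : ℂ) (r s : ℕ) :
    z * (mzv ![r, s] : ℂ) = ∑' x : ℕ × ℕ,
      z / (((x.2 + x.1 + 2 : ℕ) : ℂ) ^ r * ((x.2 + 1 : ℕ) : ℂ) ^ s) := by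
  rw [mzv, ← mzvRangeEquivTwo.tsum_eq, Complex.ofReal_tsum, ← tsum_mul_left]
  refine tsum_congr fun x => ?_
  simp only [mzvTerm, mzvRangeEquivTwo, Equiv.coe_fn_mk, Fin.prod_univ_two]
  rw [div_eq_mul_inv]
  congr 1
  simp
  ring

theorem summable_mzv_two_one_one : Summable fun x : ℕ × ℕ × ℕ =>
    1 / ((x.2.2 + x.2.1 + x.1 + 3 : ℕ) : ℝ) ^ 2 * ((1 / ((x.2.2 + x.2.1 + 2 : ℕ) : ℝ)) *
      (1 / ((x.2.2 + 1 : ℕ) : ℝ))) := by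
  have h := mzvRangeEquivThree.summable_iff.2
    (summable_mzvTerm 3 (mzvIndexEquivThree (0, 0, 0)))
  refine h.congr fun x => ?_
  simp [mzvTerm, mzvRangeEquivThree, mzvIndexEquivThree, Fin.prod_univ_three, mul_assoc]
  ring

theorem summable_mzv_two_one : Summable fun x : ℕ × ℕ =>
    1 / ((x.2 + x.1 + 2 : ℕ) : ℝ) ^ 2 * (1 / ((x.2 + 1 : ℕ) : ℝ)) := by
  have h := mzvRangeEquivTwo.summable_iff.2
    (summable_mzvTerm 2 (mzvIndexEquivTwo (0, 0)))
  refine h.congr fun x => ?_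
  simp [mzvTerm, mzvRangeEquivTwo, mzvIndexEquivTwo, Fin.prod_univ_two]
  ring

/-- Each exponent is summed as a geometric series. The radii 3, 2, 1 are the least values of k, m, n
in k > m > n > 0. -/
theorem hasSum_mzvGen_three {u w v : ℂ} (hu : ‖u‖ < 3) (hw : ‖w‖ < 2) (hv : ‖v‖ < 1) :
    Summable (mzvGenTerm 3 ![u, w, v]) ∧
    HasSum (fun x : ℕ × ℕ × ℕ =>
      (1 / (((x.2.2 + x.2.1 + x.1 + 3 : ℕ) : ℂ) - u) - 1 / ((x.2.2 + x.2.1 + x.1 + 3 : ℕ) : ℂ)) *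
        (1 / (((x.2.2 + x.2.1 + 2 : ℕ) : ℂ) - w) * (1 / (((x.2.2 + 1 : ℕ) : ℂ) - v))))
      (mzvGen 3 ![u, w, v]) := by
  have hT : ∀ i, mzvGenTerm 3 ![u, w, v] (mzvIndexEquivThree i) = ∑' x : ℕ × ℕ × ℕ,
      u ^ (i.1 + 1) / ((x.2.2 + x.2.1 + x.1 + 3 : ℕ) : ℂ) ^ (i.1 + 2) *
        (w ^ i.2.1 / ((x.2.2 + x.2.1 + 2 : ℕ) : ℂ) ^ (i.2.1 + 1) *
          (v ^ i.2.2 / ((x.2.2 + 1 : ℕ) : ℂ) ^ (i.2.2 + 1))) := by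
    intro i
    simp only [mzvGenTerm, mzvIndexEquivThree, Equiv.coe_fn_mk, mul_mzv_three]
    refine tsum_congr fun x => ?_
    simp [Fin.prod_univ_three, div_eq_mul_inv]
    ring
  have h := AbsHasSum.swap
    (((summable_mzv_two_one_one.mul_left (‖u‖ * (3 : ℕ) / ((3 : ℕ) - ‖u‖))).mul_left
      ((2 : ℕ) / ((2 : ℕ) - ‖w‖))).mul_left ((1 : ℕ) / ((1 : ℕ) - ‖v‖))) fun x =>
    ((AbsHasSum.geom_succ (x := u) (K := 3) (k := x.2.2 + x.2.1 + x.1 + 3) (by exact_mod_cast hu)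
      (by omega)).mul
    ((AbsHasSum.geom (x := w) (K := 2) (k := x.2.2 + x.2.1 + 2) (by exact_mod_cast hw)
      (by omega)).mul
    (AbsHasSum.geom (x := v) (K := 1) (k := x.2.2 + 1) (by exact_mod_cast hv)
      (by omega)))).mono (le_of_eq (by ring))
  simp only [← hT] at h
  rw [mzvIndexEquivThree.tsum_eq] at h
  exact ⟨mzvIndexEquivThree.summable_iff.1 h.1, h.2⟩

theorem hasSum_mzv_one_middle {u v : ℂ} (hu : ‖u‖ < 3) (hv : ‖v‖ < 1) :
    Summable (fun s : MzvIndex 2 =>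
      u ^ (s.1 0 - 1) * v ^ (s.1 1 - 1) * (mzv ![s.1 0, 1, s.1 1] : ℂ)) ∧
    HasSum (fun x : ℕ × ℕ × ℕ =>
      (1 / (((x.2.2 + x.2.1 + x.1 + 3 : ℕ) : ℂ) - u) - 1 / ((x.2.2 + x.2.1 + x.1 + 3 : ℕ) : ℂ)) *
        (1 / (((x.2.2 + 1 : ℕ) : ℂ) - v) * (1 / ((x.2.2 + x.2.1 + 2 : ℕ) : ℂ))))
      (∑' s : MzvIndex 2, u ^ (s.1 0 - 1) * v ^ (s.1 1 - 1) * (mzv ![s.1 0, 1, s.1 1] : ℂ)) := by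
  have hT : ∀ i : ℕ × ℕ, u ^ ((mzvIndexEquivTwo i).1 0 - 1) * v ^ ((mzvIndexEquivTwo i).1 1 - 1) *
      (mzv ![(mzvIndexEquivTwo i).1 0, 1, (mzvIndexEquivTwo i).1 1] : ℂ) = ∑' x : ℕ × ℕ × ℕ,
      u ^ (i.1 + 1) / ((x.2.2 + x.2.1 + x.1 + 3 : ℕ) : ℂ) ^ (i.1 + 2) *
        (v ^ i.2 / ((x.2.2 + 1 : ℕ) : ℂ) ^ (i.2 + 1)) *
          (1 / ((x.2.2 + x.2.1 + 2 : ℕ) : ℂ)) := by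
    intro i
    simp only [mzvIndexEquivTwo, Equiv.coe_fn_mk, mul_mzv_three]
    refine tsum_congr fun x => ?_
    simp [div_eq_mul_inv]
    ring
  have h := AbsHasSum.swap
    ((summable_mzv_two_one_one.mul_left (‖u‖ * (3 : ℕ) / ((3 : ℕ) - ‖u‖))).mul_left
      ((1 : ℕ) / ((1 : ℕ) - ‖v‖))) fun x =>
    (((AbsHasSum.geom_succ (x := u) (K := 3) (k := x.2.2 + x.2.1 + x.1 + 3) (by exact_mod_cast hu)
      (by omega)).mul
    (AbsHasSum.geom (x := v) (K := 1) (k := x.2.2 + 1) (by exact_mod_cast hv)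
      (by omega))).mul_const (1 / ((x.2.2 + x.2.1 + 2 : ℕ) : ℂ))).mono (le_of_eq (by
        rw [norm_div, norm_one, Complex.norm_natCast]; ring))
  simp only [← hT] at h
  rw [mzvIndexEquivTwo.tsum_eq (fun s : MzvIndex 2 =>
      u ^ (s.1 0 - 1) * v ^ (s.1 1 - 1) * (mzv ![s.1 0, 1, s.1 1] : ℂ))] at h
  refine ⟨mzvIndexEquivTwo.summable_iff.1 h.1, ?_⟩
  simpa only [mul_assoc] using h.2

theorem hasSum_mzvGen_two {u v : ℂ} (hu : ‖u‖ < 2) (hv : ‖v‖ < 1) :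
    Summable (mzvGenTerm 2 ![u, v]) ∧
    HasSum (fun x : ℕ × ℕ =>
      (1 / (((x.2 + x.1 + 2 : ℕ) : ℂ) - u) - 1 / ((x.2 + x.1 + 2 : ℕ) : ℂ)) *
        (1 / (((x.2 + 1 : ℕ) : ℂ) - v)))
      (mzvGen 2 ![u, v]) := by
  have hT : ∀ i, mzvGenTerm 2 ![u, v] (mzvIndexEquivTwo i) = ∑' x : ℕ × ℕ,
      u ^ (i.1 + 1) / ((x.2 + x.1 + 2 : ℕ) : ℂ) ^ (i.1 + 2) *
        (v ^ i.2 / ((x.2 + 1 : ℕ) : ℂ) ^ (i.2 + 1)) := by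
    intro i
    simp only [mzvGenTerm, mzvIndexEquivTwo, Equiv.coe_fn_mk, mul_mzv_two]
    refine tsum_congr fun x => ?_
    simp [Fin.prod_univ_two, div_eq_mul_inv]
    ring
  have h := AbsHasSum.swap
    ((summable_mzv_two_one.mul_left (‖u‖ * (2 : ℕ) / ((2 : ℕ) - ‖u‖))).mul_left
      ((1 : ℕ) / ((1 : ℕ) - ‖v‖))) fun x =>
    ((AbsHasSum.geom_succ (x := u) (K := 2) (k := x.2 + x.1 + 2) (by exact_mod_cast hu)
      (by omega)).mul
    (AbsHasSum.geom (x := v) (K := 1) (k := x.2 + 1) (by exact_mod_cast hv)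
      (by omega))).mono (le_of_eq (by ring))
  simp only [← hT] at h
  rw [mzvIndexEquivTwo.tsum_eq] at h
  exact ⟨mzvIndexEquivTwo.summable_iff.1 h.1, h.2⟩

/-- The natural numbers `s ≥ r`, enumerated. -/
def addEquivSubtypeLe (r : ℕ) : ℕ ≃ {s : ℕ // r ≤ s} where
  toFun i := ⟨i + r, Nat.le_add_left r i⟩
  invFun s := s.1 - r
  left_inv i := by simp
  right_inv s := Subtype.ext (Nat.sub_add_cancel s.2)

theorem hasSum_mzv_two_left {v : ℂ} (hv : ‖v‖ < 1) :
    Summable (fun s : {s : ℕ // 1 ≤ s} => v ^ (s.1 - 1) * (mzv ![2, s.1] : ℂ)) ∧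
    HasSum (fun x : ℕ × ℕ =>
      1 / (((x.2 + 1 : ℕ) : ℂ) - v) * (1 / ((x.2 + x.1 + 2 : ℕ) : ℂ) ^ 2))
      (∑' s : {s : ℕ // 1 ≤ s}, v ^ (s.1 - 1) * (mzv ![2, s.1] : ℂ)) := by
  have hT : ∀ i : ℕ, v ^ ((addEquivSubtypeLe 1 i).1 - 1) *
      (mzv ![2, (addEquivSubtypeLe 1 i).1] : ℂ) = ∑' x : ℕ × ℕ,
        v ^ i / ((x.2 + 1 : ℕ) : ℂ) ^ (i + 1) * (1 / ((x.2 + x.1 + 2 : ℕ) : ℂ) ^ 2) := by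
    intro i
    simp only [addEquivSubtypeLe, Equiv.coe_fn_mk, mul_mzv_two]
    refine tsum_congr fun x => ?_
    simp [div_eq_mul_inv]
    ring
  have h := AbsHasSum.swap
    (summable_mzv_two_one.mul_left ((1 : ℕ) / ((1 : ℕ) - ‖v‖))) fun x =>
    ((AbsHasSum.geom (x := v) (K := 1) (k := x.2 + 1) (by exact_mod_cast hv)
      (by omega)).mul_const (1 / ((x.2 + x.1 + 2 : ℕ) : ℂ) ^ 2)).mono (le_of_eq (by
        rw [norm_div, norm_one, norm_pow, Complex.norm_natCast]; ring))
  simp only [← hT] at h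
  rw [(addEquivSubtypeLe 1).tsum_eq (fun s : {s : ℕ // 1 ≤ s} =>
    v ^ (s.1 - 1) * (mzv ![2, s.1] : ℂ))] at h
  exact ⟨(addEquivSubtypeLe 1).summable_iff.1 h.1, h.2⟩

theorem hasSum_mzv_one_right {u : ℂ} (hu : ‖u‖ < 2) :
    Summable (fun s : {s : ℕ // 2 ≤ s} => u ^ (s.1 - 1) * (mzv ![s.1, 1] : ℂ)) ∧
    HasSum (fun x : ℕ × ℕ =>
      (1 / (((x.2 + x.1 + 2 : ℕ) : ℂ) - u) - 1 / ((x.2 + x.1 + 2 : ℕ) : ℂ)) *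
        (1 / ((x.2 + 1 : ℕ) : ℂ)))
      (∑' s : {s : ℕ // 2 ≤ s}, u ^ (s.1 - 1) * (mzv ![s.1, 1] : ℂ)) := by
  have hT : ∀ i : ℕ, u ^ ((addEquivSubtypeLe 2 i).1 - 1) *
      (mzv ![(addEquivSubtypeLe 2 i).1, 1] : ℂ) = ∑' x : ℕ × ℕ,
        u ^ (i + 1) / ((x.2 + x.1 + 2 : ℕ) : ℂ) ^ (i + 2) * (1 / ((x.2 + 1 : ℕ) : ℂ)) := by
    intro i
    simp only [addEquivSubtypeLe, Equiv.coe_fn_mk, mul_mzv_two]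
    refine tsum_congr fun x => ?_
    simp [div_eq_mul_inv]
    ring
  have h := AbsHasSum.swap
    (summable_mzv_two_one.mul_left (‖u‖ * (2 : ℕ) / ((2 : ℕ) - ‖u‖))) fun x =>
    ((AbsHasSum.geom_succ (x := u) (K := 2) (k := x.2 + x.1 + 2) (by exact_mod_cast hu)
      (by omega)).mul_const (1 / ((x.2 + 1 : ℕ) : ℂ))).mono (le_of_eq (by
        rw [norm_div, norm_one, Complex.norm_natCast]; ring))
  simp only [← hT] at h
  rw [(addEquivSubtypeLe 2).tsum_eq (fun s : {s : ℕ // 2 ≤ s} =>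
    u ^ (s.1 - 1) * (mzv ![s.1, 1] : ℂ))] at h
  exact ⟨(addEquivSubtypeLe 2).summable_iff.1 h.1, h.2⟩

/-! ### Harmonic numbers and regrouping of triple sums. -/

/-- The harmonic number `1 + 1 / 2 + ⋯ + 1 / n` as a complex number. -/
noncomputable def harmonicComplex (n : ℕ) : ℂ := ∑ i ∈ Finset.range n, 1 / ((i + 1 : ℕ) : ℂ)

theorem harmonicComplex_succ (n : ℕ) :
    harmonicComplex (n + 1) = harmonicComplex n + 1 / ((n + 1 : ℕ) : ℂ) :=
  Finset.sum_range_succ _ _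

theorem harmonicComplex_add (n r : ℕ) :
    harmonicComplex (n + r) =
      harmonicComplex n + ∑ i ∈ Finset.range r, 1 / ((n + i + 1 : ℕ) : ℂ) := by
  rw [harmonicComplex, Finset.sum_range_add]
  rfl

theorem harmonicComplex_reflect (n : ℕ) :
    ∑ i ∈ Finset.range n, 1 / ((n - 1 - i + 1 : ℕ) : ℂ) = harmonicComplex n :=
  Finset.sum_range_reflect (fun i => 1 / ((i + 1 : ℕ) : ℂ)) n

theorem hasSum_one_div_sub_one_div_succ (m : ℕ) :
    HasSum (fun a : ℕ => 1 / ((m + a + 1 : ℕ) : ℝ) - 1 / ((m + a + 2 : ℕ) : ℝ))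
      (1 / ((m + 1 : ℕ) : ℝ)) := by
  rw [hasSum_iff_tendsto_nat_of_nonneg]
  · have h : ∀ N : ℕ, ∑ a ∈ Finset.range N,
        (1 / ((m + a + 1 : ℕ) : ℝ) - 1 / ((m + a + 2 : ℕ) : ℝ)) =
        1 / ((m + 1 : ℕ) : ℝ) - 1 / ((N + (m + 1) : ℕ) : ℝ) := fun N => by
      have := Finset.sum_range_sub' (fun a : ℕ => 1 / ((m + a + 1 : ℕ) : ℝ)) N
      rw [show N + (m + 1) = m + N + 1 by ring]
      exact this
    simp only [h]
    have := (tendsto_const_nhds (x := 1 / ((m + 1 : ℕ) : ℝ))).sub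
      ((Filter.tendsto_add_atTop_iff_nat (m + 1)).2 tendsto_one_div_atTop_nhds_zero_nat)
    rwa [sub_zero] at this
  · intro a
    rw [sub_nonneg]
    exact one_div_le_one_div_of_le (by positivity) (by exact_mod_cast Nat.le_succ _)

/-- Raising m by one adds a telescoping series with sum 1/(m + 1). -/
theorem hasSum_harmonicComplex (m : ℕ) :
    HasSum (fun a : ℕ => 1 / ((a + 1 : ℕ) : ℂ) - 1 / ((m + a + 1 : ℕ) : ℂ))
      (harmonicComplex m) := by
  induction m with
  | zero => simp [harmonicComplex]
  | succ m ih =>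
    have h := Complex.hasSum_ofReal.2 (hasSum_one_div_sub_one_div_succ m)
    rw [harmonicComplex_succ]
    convert ih.add h using 1
    · ext a
      push_cast
      ring
    · push_cast
      rfl

/-- Summation over `a` and `i + j = N - 1` of a series on `ℕ × ℕ × ℕ`. -/
theorem HasSum.sum_range_reflect {F : ℕ × ℕ × ℕ → ℂ} {s : ℂ} (h : HasSum F s) :
    HasSum (fun y : ℕ × ℕ => ∑ i ∈ Finset.range y.2, F (y.1, y.2 - 1 - i, i)) s := by
  let e : (Σ y : ℕ × ℕ, Fin y.2) ≃ ℕ × ℕ × ℕ :=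
    { toFun := fun z => (z.1.1, z.1.2 - 1 - z.2, z.2)
      invFun := fun x => ⟨(x.1, x.2.1 + x.2.2 + 1), ⟨x.2.2, by simp⟩⟩
      left_inv := by
        rintro ⟨⟨a, N⟩, ⟨i, hi⟩⟩
        have key : ∀ N', N' = N → ∀ hi' : i < N',
            (⟨(a, N'), ⟨i, hi'⟩⟩ : Σ y : ℕ × ℕ, Fin y.2) = ⟨(a, N), ⟨i, hi⟩⟩ := by
          rintro _ rfl _
          rfl
        exact key _ (by simp at hi ⊢; omega) _
      right_inv := by
        rintro ⟨a, b, c⟩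
        simp }
  have h' := (e.hasSum_iff.2 h).sigma fun y => hasSum_fintype _
  simp only [Finset.sum_range]
  exact h'

/-! ### Convergence of the auxiliary series β. -/

/-- With k = a + b + c + 3, split k² = k^(1/3) · k^(4/3) · k^(1/3) and bound the factors below by
powers of a + 1, b + 1, c + 1. Each variable then has total exponent 4/3 > 1. -/
theorem summable_one_div_sq_mul_mul : Summable fun x : ℕ × ℕ × ℕ =>
    1 / ((x.2.2 + x.2.1 + x.1 + 3 : ℕ) : ℝ) ^ 2 *
      (1 / ((x.1 + 1 : ℕ) : ℝ) * (1 / ((x.2.2 + 1 : ℕ) : ℝ))) := by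
  have h1 : Summable fun n : ℕ => 1 / ((n + 1 : ℕ) : ℝ) ^ (4 / 3 : ℝ) :=
    (summable_nat_add_iff 1).2 (Real.summable_one_div_nat_rpow.2 (by norm_num))
  have h0 : ∀ n : ℕ, 0 ≤ 1 / ((n + 1 : ℕ) : ℝ) ^ (4 / 3 : ℝ) := fun n => by positivity
  have h3 := h1.mul_of_nonneg (h1.mul_of_nonneg h1 h0 h0) h0
    fun x => mul_nonneg (h0 _) (h0 _)
  refine Summable.of_nonneg_of_le (fun x => by positivity) (fun ⟨a, b, c⟩ => ?_) h3
  simp only [one_div_mul_one_div]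
  refine one_div_le_one_div_of_le (by positivity) ?_
  have hle : ∀ i : ℕ, i + 1 ≤ c + b + a + 3 → ∀ r : ℝ, 0 ≤ r →
      ((i + 1 : ℕ) : ℝ) ^ r ≤ ((c + b + a + 3 : ℕ) : ℝ) ^ r := fun i hi r hr =>
    Real.rpow_le_rpow (by positivity) (by exact_mod_cast hi) hr
  have hsplit : ∀ i : ℕ, ((i + 1 : ℕ) : ℝ) ^ (4 / 3 : ℝ) =
      ((i + 1 : ℕ) : ℝ) * ((i + 1 : ℕ) : ℝ) ^ (1 / 3 : ℝ) := fun i => by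
    have : (0 : ℝ) < ((i + 1 : ℕ) : ℝ) := by positivity
    rw [show (4 / 3 : ℝ) = 1 + 1 / 3 by norm_num, Real.rpow_add this, Real.rpow_one]
  have hk : ((c + b + a + 3 : ℕ) : ℝ) ^ 2 = ((c + b + a + 3 : ℕ) : ℝ) ^ (1 / 3 : ℝ) *
      (((c + b + a + 3 : ℕ) : ℝ) ^ (4 / 3 : ℝ) * ((c + b + a + 3 : ℕ) : ℝ) ^ (1 / 3 : ℝ)) := by
    have : (0 : ℝ) < ((c + b + a + 3 : ℕ) : ℝ) := by positivity
    rw [← Real.rpow_add this, ← Real.rpow_add this, ← Real.rpow_natCast]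
    norm_num
  calc _ = ((a + 1 : ℕ) : ℝ) ^ (1 / 3 : ℝ) * (((b + 1 : ℕ) : ℝ) ^ (4 / 3 : ℝ) *
        ((c + 1 : ℕ) : ℝ) ^ (1 / 3 : ℝ)) * (((a + 1 : ℕ) : ℝ) * ((c + 1 : ℕ) : ℝ)) := by
        rw [hsplit a, hsplit c]; ring
    _ ≤ _ := by
        rw [hk]
        gcongr ?_ * (?_ * ?_) * _
        · exact hle a (by omega) _ (by norm_num)
        · exact hle b (by omega) _ (by norm_num)
        · exact hle c (by omega) _ (by norm_num)

theorem AbsHasSum.norm_le {ι : Type*} {f : ι → ℂ} {s : ℂ} {b : ℝ} (h : AbsHasSum f s b) :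
    ‖s‖ ≤ b := by
  rw [← h.hasSum.tsum_eq]
  exact (norm_tsum_le_tsum_norm h.summable_norm).trans h.tsum_norm_le

theorem summable_mul_one_div_sub {u v : ℂ} (hu : ‖u‖ < 3) (hv : ‖v‖ < 1) :
    Summable fun x : ℕ × ℕ × ℕ =>
      (1 / (((x.2.2 + x.2.1 + x.1 + 3 : ℕ) : ℂ) - u) - 1 / ((x.2.2 + x.2.1 + x.1 + 3 : ℕ) : ℂ)) *
        (1 / ((x.1 + 1 : ℕ) : ℂ) * (1 / (((x.2.2 + 1 : ℕ) : ℂ) - v))) := by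
  refine Summable.of_norm_bounded ((summable_one_div_sq_mul_mul.mul_left
    (‖u‖ * (3 : ℕ) / ((3 : ℕ) - ‖u‖))).mul_left ((1 : ℕ) / ((1 : ℕ) - ‖v‖))) fun x => ?_
  have hf := (AbsHasSum.geom_succ (x := u) (K := 3) (k := x.2.2 + x.2.1 + x.1 + 3)
    (by exact_mod_cast hu) (by omega)).norm_le
  have hg := (AbsHasSum.geom (x := v) (K := 1) (k := x.2.2 + 1) (by exact_mod_cast hv)
      (by omega)).norm_le
  have ha : ‖1 / ((x.1 + 1 : ℕ) : ℂ)‖ = 1 / ((x.1 + 1 : ℕ) : ℝ) := by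
    rw [norm_div, norm_one, Complex.norm_natCast]
  rw [norm_mul, norm_mul, ha]
  refine (mul_le_mul hf (mul_le_mul_of_nonneg_left hg (by positivity)) (by positivity)
    ((norm_nonneg _).trans hf)).trans_eq (by ring)

/-! ### Partial fractions and reduction from triple to double sums. -/

theorem natCast_sub_ne_zero {x : ℂ} {K k : ℕ} (hx : ‖x‖ < K) (hk : K ≤ k) : (k : ℂ) - x ≠ 0 := by
  rw [sub_ne_zero]
  rintro rfl
  rw [Complex.norm_natCast] at hx
  exact absurd hk (not_le.2 (by exact_mod_cast hx))

/-- Both sides equal ug / ((m - u)kd). On the right k occurs only in 1/d - 1/k with d = k - m, which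
sums over k > m to H_m. -/
theorem partialFraction_add {k m d u : ℂ} (hk : k = m + d) (hk0 : k ≠ 0) (hm0 : m ≠ 0)
    (hd0 : d ≠ 0) (hku : k - u ≠ 0) (hmu : m - u ≠ 0) (g : ℂ) :
    (1 / (k - u) - 1 / k) * (1 / (m - u) * g) + (1 / (k - u) - 1 / k) * (1 / d * g) =
      (1 / (m - u) - 1 / m) * g * (1 / d - 1 / k) := by
  obtain rfl : d = k - m := by rw [hk]; ring
  field_simp
  ring

/-- The numerator (m - v) - (n - v) = d cancels n - v, so n remains only in 1/d, which sums over n <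
m to H_{m-1}. -/
theorem partialFraction_sub {m n d v : ℂ} (hm : m = n + d) (hd0 : d ≠ 0) (hmv : m - v ≠ 0)
    (hnv : n - v ≠ 0) (f : ℂ) :
    f * (1 / d * (1 / (n - v))) - f * (1 / (m - v) * (1 / (n - v))) =
      f * (1 / (m - v)) * (1 / d) := by
  obtain rfl : d = m - n := by rw [hm]; ring
  field_simp
  ring

/-- The identity
`∑_{k > m > n > 0} f(k) (1 / (m - u) + 1 / (m - v) - 1 / m) / (n - v)
  = ∑_{k > n > 0} f(k) (1 / k + 1 / n) / (n - v)` with `f(k) = 1 / (k - u) - 1 / k`. -/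
theorem hasSum_two_of_hasSum_three {u v : ℂ} (hu : ‖u‖ < 2) (hv : ‖v‖ < 1) {G₁ G₂ G₃ : ℂ}
    (h₁ : HasSum (fun x : ℕ × ℕ × ℕ =>
      (1 / (((x.2.2 + x.2.1 + x.1 + 3 : ℕ) : ℂ) - u) - 1 / ((x.2.2 + x.2.1 + x.1 + 3 : ℕ) : ℂ)) *
        (1 / (((x.2.2 + x.2.1 + 2 : ℕ) : ℂ) - u) * (1 / (((x.2.2 + 1 : ℕ) : ℂ) - v)))) G₁)
    (h₂ : HasSum (fun x : ℕ × ℕ × ℕ =>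
      (1 / (((x.2.2 + x.2.1 + x.1 + 3 : ℕ) : ℂ) - u) - 1 / ((x.2.2 + x.2.1 + x.1 + 3 : ℕ) : ℂ)) *
        (1 / (((x.2.2 + x.2.1 + 2 : ℕ) : ℂ) - v) * (1 / (((x.2.2 + 1 : ℕ) : ℂ) - v)))) G₂)
    (h₃ : HasSum (fun x : ℕ × ℕ × ℕ =>
      (1 / (((x.2.2 + x.2.1 + x.1 + 3 : ℕ) : ℂ) - u) - 1 / ((x.2.2 + x.2.1 + x.1 + 3 : ℕ) : ℂ)) *
        (1 / (((x.2.2 + 1 : ℕ) : ℂ) - v) * (1 / ((x.2.2 + x.2.1 + 2 : ℕ) : ℂ)))) G₃) :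
    HasSum (fun y : ℕ × ℕ =>
      (1 / (((y.2 + y.1 + 2 : ℕ) : ℂ) - u) - 1 / ((y.2 + y.1 + 2 : ℕ) : ℂ)) *
        (1 / (((y.2 + 1 : ℕ) : ℂ) - v)) *
        (1 / ((y.2 + y.1 + 2 : ℕ) : ℂ) + 1 / ((y.2 + 1 : ℕ) : ℂ))) (G₁ + G₂ - G₃) := by
  have hnz : ∀ {k : ℕ}, 2 ≤ k → (k : ℂ) - u ≠ 0 := natCast_sub_ne_zero (by exact_mod_cast hu)
  have hnz' : ∀ {k : ℕ}, 1 ≤ k → (k : ℂ) - v ≠ 0 := natCast_sub_ne_zero (by exact_mod_cast hv)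
  obtain ⟨β, hB⟩ := summable_mul_one_div_sub (hu.trans (by norm_num)) hv
  -- Exchanging the gaps k - m and m - n gives the second form of β.
  let e : ℕ × ℕ × ℕ ≃ ℕ × ℕ × ℕ :=
    ⟨fun x => (x.2.1, x.1, x.2.2), fun x => (x.2.1, x.1, x.2.2), fun _ => rfl, fun _ => rfl⟩
  have hD := e.hasSum_iff.2 hB
  -- the part of the first series in which `k` can be summed out
  have hA : HasSum (fun y : ℕ × ℕ =>
      (1 / (((y.2 + y.1 + 2 : ℕ) : ℂ) - u) - 1 / ((y.2 + y.1 + 2 : ℕ) : ℂ)) *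
        (1 / (((y.2 + 1 : ℕ) : ℂ) - v)) * harmonicComplex (y.2 + y.1 + 2)) (G₁ + β) := by
    let s : (ℕ × ℕ) × ℕ ≃ ℕ × ℕ × ℕ := Equiv.prodComm _ _
    refine (s.hasSum_iff.2 (h₁.add hB)).prod_fiberwise fun y => ?_
    have := (hasSum_harmonicComplex (y.2 + y.1 + 2)).mul_left
      ((1 / (((y.2 + y.1 + 2 : ℕ) : ℂ) - u) - 1 / ((y.2 + y.1 + 2 : ℕ) : ℂ)) *
        (1 / (((y.2 + 1 : ℕ) : ℂ) - v)))
    refine this.congr_fun fun a => ?_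
    simp only [Function.comp, s, Equiv.prodComm_apply, Prod.swap]
    rw [show y.2 + y.1 + 2 + a + 1 = y.2 + y.1 + a + 3 by ring]
    exact partialFraction_add (by push_cast; ring) (Nat.cast_ne_zero.2 (by omega))
      (Nat.cast_ne_zero.2 (by omega)) (Nat.cast_ne_zero.2 (by omega)) (hnz (by omega))
      (hnz (by omega)) _
  -- the part of the second series in which the smallest index can be summed out
  have hE : HasSum (fun y : ℕ × ℕ =>
      (1 / (((y.2 + y.1 + 2 : ℕ) : ℂ) - u) - 1 / ((y.2 + y.1 + 2 : ℕ) : ℂ)) *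
        (1 / (((y.2 + 1 : ℕ) : ℂ) - v)) * harmonicComplex y.2) (β - G₂) := by
    refine (hD.sub h₂).sum_range_reflect.congr_fun fun y => ?_
    rw [← harmonicComplex_reflect, Finset.mul_sum]
    refine Finset.sum_congr rfl fun i hi => ?_
    obtain ⟨r, hr⟩ : ∃ r, y.2 = i + r + 1 :=
      ⟨y.2 - 1 - i, by have := Finset.mem_range.1 hi; omega⟩
    have hr' : y.2 - 1 - i = r := by omega
    simp only [Function.comp, e, Equiv.coe_fn_mk, hr']
    rw [show i + y.1 + r + 3 = y.2 + y.1 + 2 by omega,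
      show i + r + y.1 + 3 = y.2 + y.1 + 2 by omega, show i + r + 2 = y.2 + 1 by omega]
    refine (partialFraction_sub ?_ (Nat.cast_ne_zero.2 (by omega)) (hnz' (by omega))
      (hnz' (by omega)) _).symm
    rw [hr]; push_cast; ring
  -- Here the middle index m, strictly between n and k, is summed out.
  have hF : HasSum (fun y : ℕ × ℕ =>
      (1 / (((y.2 + y.1 + 2 : ℕ) : ℂ) - u) - 1 / ((y.2 + y.1 + 2 : ℕ) : ℂ)) *
        (1 / (((y.2 + 1 : ℕ) : ℂ) - v)) *
          (harmonicComplex (y.2 + 1 + y.1) - harmonicComplex (y.2 + 1))) G₃ := by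
    let s : ℕ × ℕ × ℕ ≃ ℕ × ℕ × ℕ :=
      ⟨fun x => (x.2.1, x.2.2, x.1), fun x => (x.2.2, x.1, x.2.1), fun _ => rfl, fun _ => rfl⟩
    rw [← (Equiv.prodComm ℕ ℕ).hasSum_iff]
    refine (s.hasSum_iff.2 h₃).sum_range_reflect.congr_fun fun y => ?_
    rw [Function.comp, Equiv.prodComm_apply, harmonicComplex_add, add_sub_cancel_left,
      Finset.mul_sum]
    refine Finset.sum_congr rfl fun i hi => ?_
    have hi' := Finset.mem_range.1 hi
    simp only [Function.comp, s, Equiv.coe_fn_mk, Prod.swap]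
    rw [show y.1 + i + (y.2 - 1 - i) + 3 = y.1 + y.2 + 2 by omega,
      show y.1 + 1 + i + 1 = y.1 + i + 2 by ring, mul_assoc]
  rw [show G₁ + G₂ - G₃ = G₁ + β - (β - G₂) - G₃ by ring]
  refine ((hA.sub hE).sub hF).congr_fun fun y => ?_
  -- With k = y.2 + y.1 + 2 and n = y.2 + 1, the factor is H_k - H_{n-1} - (H_{k-1} - H_n) = 1/k +
  -- 1/n.
  rw [show y.2 + y.1 + 2 = y.2 + 1 + y.1 + 1 by ring, harmonicComplex_succ, harmonicComplex_succ]
  ring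

theorem mainTheorem10 (x₁ x₂ : ℂ) (h₁ : x₁ ≠ 0) (h₂ : x₂ ≠ 0) (hx₁ : ‖x₁‖ < 2) (hx₂ : ‖x₂‖ < 1) :
    Summable (mzvGenTerm 3 ![x₁, x₁, x₂]) ∧
    Summable (mzvGenTerm 3 ![x₁, x₂, x₂]) ∧
    Summable (mzvGenTerm 2 ![x₁, x₂]) ∧
    Summable (fun s : MzvIndex 2 =>
      x₁ ^ (s.1 0 - 1) * x₂ ^ (s.1 1 - 1) * (mzv ![s.1 0, 1, s.1 1] : ℂ)) ∧
    Summable (fun s : {s : ℕ // 1 ≤ s} => x₂ ^ (s.1 - 1) * (mzv ![2, s.1] : ℂ)) ∧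
    Summable (fun s : {s : ℕ // 2 ≤ s} => x₁ ^ (s.1 - 1) * (mzv ![s.1, 1] : ℂ)) ∧
    mzvGen 3 ![x₁, x₁, x₂] + mzvGen 3 ![x₁, x₂, x₂]
        - 1 / x₁ * mzvGen 2 ![x₁, x₂] - 1 / x₂ * mzvGen 2 ![x₁, x₂]
      = (∑' s : MzvIndex 2,
          x₁ ^ (s.1 0 - 1) * x₂ ^ (s.1 1 - 1) * (mzv ![s.1 0, 1, s.1 1] : ℂ))
        - (∑' s : {s : ℕ // 1 ≤ s}, x₂ ^ (s.1 - 1) * (mzv ![2, s.1] : ℂ))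
        - 1 / x₂ * ∑' s : {s : ℕ // 2 ≤ s}, x₁ ^ (s.1 - 1) * (mzv ![s.1, 1] : ℂ) := by
  have hu3 : ‖x₁‖ < 3 := hx₁.trans (by norm_num)
  obtain ⟨s₁, g₁⟩ := hasSum_mzvGen_three hu3 hx₁ hx₂
  obtain ⟨s₂, g₂⟩ := hasSum_mzvGen_three hu3 (hx₂.trans (by norm_num)) hx₂
  obtain ⟨s₃, g₃⟩ := hasSum_mzvGen_two hx₁ hx₂
  obtain ⟨s₄, g₄⟩ := hasSum_mzv_one_middle hu3 hx₂
  obtain ⟨s₅, g₅⟩ := hasSum_mzv_two_left hx₂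
  obtain ⟨s₆, g₆⟩ := hasSum_mzv_one_right hx₁
  refine ⟨s₁, s₂, s₃, s₄, s₅, s₆, ?_⟩
  have hL := hasSum_two_of_hasSum_three hx₁ hx₂ g₁ g₂ g₄
  have hR := (((g₃.mul_left (1 / x₁)).add (g₃.mul_left (1 / x₂))).sub g₅).sub
    (g₆.mul_left (1 / x₂))
  have key := hL.unique (hR.congr_fun fun y => ?_)
  · linear_combination key
  -- The termwise identity rests on f(k)/k = f(k)/x₁ - 1/k² and 1/(n(n - x₂)) = (1/(n - x₂) -
  -- 1/n)/x₂.
  · have hk : ((y.2 + y.1 + 2 : ℕ) : ℂ) ≠ 0 := Nat.cast_ne_zero.2 (by omega)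
    have hn : ((y.2 + 1 : ℕ) : ℂ) ≠ 0 := Nat.cast_ne_zero.2 (by omega)
    have hku := natCast_sub_ne_zero (x := x₁) (K := 2) (k := y.2 + y.1 + 2)
      (by exact_mod_cast hx₁) (by omega)
    have hnv := natCast_sub_ne_zero (x := x₂) (K := 1) (k := y.2 + 1)
      (by exact_mod_cast hx₂) (by omega)
    generalize ((y.2 + y.1 + 2 : ℕ) : ℂ) = k at *
    generalize ((y.2 + 1 : ℕ) : ℂ) = n at *
    field_simp
    ring
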